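/- For real $a,b$ let $T_{ab}:\mathbb{R}^2\to\mathbb{R}^2$ be given by $T_{ab}(x,y)=(ax-y,x)$ if $x\ge 0$ and $T_{ab}(x,y)=(bx-y,x)$ if $x<0$, and let $S_{ab}:S^1\to S^1$ be the induced circle map $S_{ab}(v)=T_{ab}(v)/\|T_{ab}(v)\|$ on the Euclidean unit circle $S^1\subset\mathbb{R}^2$. Its rotation number $r(S_{ab})$, which is well defined modulo $1$, is $$r(S_{ab})=\lim_{n\to\infty}\frac{\tilde S^{(n)}(x)-x}{n}\qquad(x\in\mathbb{R}),$$ where $\tilde S:\mathbb{R}\to\mathbb{R}$ is any continuous lift of $S_{ab}$, i.e. $e^{2\pi i\tilde S(x)}=S_{ab}(e^{2\pi i x})$ for all $x$, with $\mathbb{R}^2$ identified with $\mathbb{C}$. **Theorem.** Let $a,b\in\mathbb{R}$. If the rotation number $r=r(S_{ab})$ is irrational, then there exists a homeomorphism $h:S^1\to S^1$ such that $h\circ S_{ab}\circ h^{-1}=\Theta_r$, where $\Theta_r:S^1\to S^1$ is the rotation by $r$, that is $\theta\mapsto\theta+2\pi r$ in the angular coordinate. -/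

import Mathlib

open Filter Topology

noncomputable section

namespace PLMap

/-- The piecewise-linear map `T_ab` of the plane. -/
def T (a b : ℝ) (v : ℝ × ℝ) : ℝ × ℝ :=
  if 0 ≤ v.1 then (a * v.1 - v.2, v.1) else (b * v.1 - v.2, v.1)

/-- `T_ab` read on `ℂ`, with `x + y i` identified with `(x, y)`. -/
def TC (a b : ℝ) (z : ℂ) : ℂ :=
  Complex.equivRealProd.symm (T a b (Complex.equivRealProd z))

theorem TC_ne_zero (a b : ℝ) {z : ℂ} (hz : z ≠ 0) : TC a b z ≠ 0 := by
  intro h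
  apply hz
  have h1 := congrArg Complex.re h
  have h2 := congrArg Complex.im h
  unfold TC T at h1 h2
  split_ifs at h1 h2 <;> simp at h1 h2 <;> simp [h2] at h1 <;>
    exact Complex.ext (by simpa using h2) (by simpa using h1)

/-- The circle map `S_ab`, sending a unit vector `z` to `T_ab z / ‖T_ab z‖`
(the norm on `ℂ` is the Euclidean norm). -/
def S (a b : ℝ) (z : Circle) : Circle :=
  ⟨TC a b z / (‖TC a b z‖ : ℂ), mem_sphere_zero_iff_norm.2 (by
    have h : ‖TC a b z‖ ≠ 0 := norm_ne_zero_iff.2 (TC_ne_zero a b z.coe_ne_zero)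
    simp [h])⟩

/-- `F` is a lift to `ℝ` of the circle map `f`; an angle `2π` lifts to `1`. -/
def IsLift (f : Circle → Circle) (F : ℝ → ℝ) : Prop :=
  Continuous F ∧ ∀ x : ℝ, Circle.exp (2 * Real.pi * F x) = f (Circle.exp (2 * Real.pi * x))

/-- `r` is a value of the rotation number of `f`: the limit of `(F^n(x) - x) / n`, for every
starting point `x`, where `F` is a lift of `f`. Changing the lift of an orientation-preserving
homeomorphism changes `r` by an integer, so that the rotation number is a class modulo `1`; the
predicate holds for all the real representatives of that class. -/
def HasRotationNumber (f : Circle → Circle) (r : ℝ) : Prop :=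
  ∃ F : ℝ → ℝ, IsLift f F ∧
    ∀ x : ℝ, Tendsto (fun n : ℕ => (F^[n] x - x) / (n : ℝ)) atTop (𝓝 r)

/-- The rigid rotation `θ ↦ θ + 2πr` of the circle. -/
def rotation (r : ℝ) (z : Circle) : Circle := Circle.exp (2 * Real.pi * r) * z

end PLMap

end

/-! This is Denjoy's theorem for a map that is only piecewise smooth. On each half-plane `T` is
linear of determinant 1, so a lift `F` of `S a b` has derivative `1 / ‖T v‖ ^ 2` away from the
angles where `cos` vanishes. This function is continuous, positive and log-Lipschitz, which gives
`BoundedDistortion`.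

Equality of translation numbers gives a monotone degree-one `H` with `H ∘ F = H + r`, continuous
because its range is dense. If `H` were constant on an interval, the images of that interval would
be disjoint modulo 1, hence of total length at most 1. By Schwartz's argument (`exists_extension`) a
slightly longer interval would also have shrinking images, although `H` keeps a fixed increment on
them. So `H` is strictly increasing and descends to the conjugacy. -/

noncomputable section

namespace PLMap

open Set

/-! ### Distortion of iterates and Schwartz's argument. -/

/-- Adjacent intervals are distorted by `f` by a factor that is exponentially controlled by their
total length. -/
def BoundedDistortion (f : ℝ → ℝ) (K : ℝ) : Prop :=
  ∀ p q s : ℝ, p ≤ q → q ≤ s →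
    (f s - f q) * (q - p) ≤ Real.exp (K * (s - p)) * (f q - f p) * (s - q)

/-- The exponents of the single steps add up along the orbit. -/
theorem BoundedDistortion.iterate {f : ℝ → ℝ} {K : ℝ} (hf : BoundedDistortion f K)
    (hmono : StrictMono f) {p q s : ℝ} (hpq : p < q) (hqs : q ≤ s) (n : ℕ) :
    (f^[n] s - f^[n] q) * (q - p) ≤
      Real.exp (K * ∑ k ∈ Finset.range n, (f^[k] s - f^[k] p)) *
        (f^[n] q - f^[n] p) * (s - q) := by
  induction n with
  | zero => simp [mul_comm]
  | succ n ih =>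
    have hn := hmono.iterate n
    have hA : 0 < f^[n] q - f^[n] p := sub_pos.2 (hn hpq)
    have h1 := hf _ _ _ (hn hpq).le (hn.monotone hqs)
    rw [Finset.sum_range_succ, mul_add, Real.exp_add]
    simp only [Function.iterate_succ_apply']
    have hA' : 0 < f (f^[n] q) - f (f^[n] p) := sub_pos.2 (hmono (hn hpq))
    set E := Real.exp (K * ∑ k ∈ Finset.range n, (f^[k] s - f^[k] p))
    set e := Real.exp (K * (f^[n] s - f^[n] p))
    have he : 0 < e := Real.exp_pos _
    refine le_of_mul_le_mul_right ?_ hA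
    calc _ = (f (f^[n] s) - f (f^[n] q)) * (f^[n] q - f^[n] p) * (q - p) := by ring
      _ ≤ e * (f (f^[n] q) - f (f^[n] p)) * (f^[n] s - f^[n] q) * (q - p) :=
        mul_le_mul_of_nonneg_right h1 (sub_pos.2 hpq).le
      _ = e * (f (f^[n] q) - f (f^[n] p)) * ((f^[n] s - f^[n] q) * (q - p)) := by ring
      _ ≤ e * (f (f^[n] q) - f (f^[n] p)) * (E * (f^[n] q - f^[n] p) * (s - q)) :=
        mul_le_mul_of_nonneg_left ih (by positivity)
      _ = _ := by ring

/-- Schwartz's argument: an interval whose images have bounded total length can be enlarged to the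
right so that the images of the added piece are no longer than those of the interval. -/
theorem BoundedDistortion.exists_extension {f : ℝ → ℝ} {K : ℝ} (hf : BoundedDistortion f K)
    (hK : 0 ≤ K) (hmono : StrictMono f) {p q : ℝ} (hpq : p < q)
    (hsum : ∀ n, ∑ k ∈ Finset.range n, (f^[k] q - f^[k] p) ≤ 1) :
    ∃ s, q < s ∧ ∀ n, f^[n] s - f^[n] q ≤ f^[n] q - f^[n] p := by
  have hd : 0 < q - p := sub_pos.2 hpq
  -- If the claim holds before time `n`, the images of `[p, s]` are at most twice those of `[p, q]`,
  -- so their sum is at most 2; the factor `exp (-(K * 2))` cancels the resulting distortion.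
  refine ⟨q + Real.exp (-(K * 2)) * (q - p), by linarith [mul_pos (Real.exp_pos (-(K * 2))) hd], ?_⟩
  set s := q + Real.exp (-(K * 2)) * (q - p) with hs
  have hqs : q ≤ s := by linarith [mul_pos (Real.exp_pos (-(K * 2))) hd]
  intro n
  induction n using Nat.strong_induction_on with
  | _ n ih =>
    have h1 : ∑ k ∈ Finset.range n, (f^[k] s - f^[k] p) ≤ 2 := by
      calc _ ≤ ∑ k ∈ Finset.range n, 2 * (f^[k] q - f^[k] p) :=
            Finset.sum_le_sum fun k hk => by linarith [ih k (Finset.mem_range.1 hk)]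
        _ ≤ 2 := by rw [← Finset.mul_sum]; linarith [hsum n]
    have hA : 0 < f^[n] q - f^[n] p := sub_pos.2 (hmono.iterate n hpq)
    have h2 : Real.exp (K * ∑ k ∈ Finset.range n, (f^[k] s - f^[k] p)) ≤ Real.exp (K * 2) :=
      Real.exp_le_exp.2 (mul_le_mul_of_nonneg_left h1 hK)
    refine le_of_mul_le_mul_right ?_ hd
    calc _ ≤ _ := hf.iterate hmono hpq hqs n
      _ ≤ Real.exp (K * 2) * (f^[n] q - f^[n] p) * (s - q) := by gcongr
      _ = (Real.exp (K * 2) * Real.exp (-(K * 2))) * ((f^[n] q - f^[n] p) * (q - p)) := by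
        rw [hs]; ring
      _ = _ := by rw [← Real.exp_add]; simp

/-! ### Semiconjugacies to an irrational rotation. -/

theorem fract_nat_mul_injective {τ : ℝ} (hτ : Irrational τ) :
    Function.Injective fun k : ℕ => Int.fract (k * τ) := by
  intro j k h
  obtain ⟨z, hz⟩ := Int.fract_eq_fract.1 h
  by_contra hne
  have hne' : (j : ℤ) - k ≠ 0 := sub_ne_zero.2 (by exact_mod_cast hne)
  refine (hτ.intCast_mul hne').ne_int z ?_
  push_cast
  linarith

section Semiconj

variable {f : ℝ → ℝ} {τ : ℝ} {H : CircleDeg1Lift}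

theorem semiconj_iterate (hH : ∀ x, H (f x) = H x + τ) (n : ℕ) (x : ℝ) :
    H (f^[n] x) = H x + n * τ := by
  induction n with
  | zero => simp
  | succ n ih => rw [Function.iterate_succ_apply', hH, ih]; push_cast; ring

theorem lt_add_one_of_map_lt {x y : ℝ} (h : H x < H y + 1) : x < y + 1 := by
  by_contra! hc
  have := H.monotone hc
  rw [H.map_add_one] at this
  linarith

/-- The images of an interval on which a semiconjugacy to an irrational rotation is constant are
pairwise disjoint modulo `1`. -/
theorem sum_length_iterate_le_one (hmono : Monotone f) (hτ : Irrational τ)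
    (hH : ∀ x, H (f x) = H x + τ) {p q : ℝ} (hpq : p ≤ q) (hc : H p = H q) (n : ℕ) :
    ∑ k ∈ Finset.range n, (f^[k] q - f^[k] p) ≤ 1 := by
  -- After this integer shift `H` is constant on `A k`, with value `H p + Int.fract (k * τ)`; these
  -- values are distinct.
  set A : ℕ → Set ℝ := fun k => Icc (f^[k] p - ⌊k * τ⌋) (f^[k] q - ⌊k * τ⌋) with hA
  have hval : ∀ k, ∀ x ∈ A k, H x = H p + Int.fract (k * τ) := by
    intro k x hx
    have h1 := H.monotone hx.1
    have h2 := H.monotone hx.2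
    rw [H.map_sub_int, semiconj_iterate hH] at h1 h2
    have := Int.self_sub_floor (k * τ)
    linarith
  have hdisj : (↑(Finset.range n) : Set ℕ).PairwiseDisjoint A := by
    intro j _ k _ hjk
    refine Set.disjoint_left.2 fun x hj hk => hjk (fract_nat_mul_injective hτ ?_)
    have := hval j x hj
    have := hval k x hk
    dsimp only
    linarith
  have hsub : (⋃ k ∈ Finset.range n, A k) ⊆ Icc p (p + 1) := by
    refine iUnion₂_subset fun k _ x hx => ⟨?_, ?_⟩
    -- A point left of `p` forces `Int.fract (k * τ) = 0`, hence `k = 0`, but `A 0` is `[p, q]`.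
    · by_contra! hlt
      have h1 := H.monotone hlt.le
      have h2 := hval k x hx
      have h3 := Int.fract_nonneg (k * τ)
      have h4 : k = 0 := fract_nat_mul_injective hτ (by simp; linarith)
      subst h4
      have := hx.1
      simp at this
      linarith
    · refine (lt_add_one_of_map_lt (H := H) ?_).le
      rw [hval k x hx]
      linarith [Int.fract_lt_one (k * τ)]
  have hvol := MeasureTheory.measure_mono (μ := MeasureTheory.volume) hsub
  rw [MeasureTheory.measure_biUnion_finset hdisj fun k _ => measurableSet_Icc] at hvol
  simp only [hA, Real.volume_Icc] at hvol
  rw [← ENNReal.ofReal_sum_of_nonneg, ENNReal.ofReal_le_ofReal_iff (by linarith)] at hvol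
  · simpa using hvol
  · intro k _
    have := hmono.iterate k hpq
    linarith

/-- `H x - x` is periodic, so it factors through a compact circle. -/
theorem uniformContinuous_of_continuous_deg1 (hH : Continuous H) : UniformContinuous H := by
  have hper : Function.Periodic (fun x => H x - x) 1 := fun x => by
    simp only [H.map_add_one]; ring
  have hc : Continuous fun x => H x - x := hH.sub continuous_id
  have : UniformContinuous fun x => H x - x := by
    have hlift : Continuous (hper.lift : AddCircle (1 : ℝ) → ℝ) := by
      exact continuous_quot_lift _ hc
    have : Fact ((0 : ℝ) < 1) := ⟨one_pos⟩
    have h1 : UniformContinuous (hper.lift : AddCircle (1 : ℝ) → ℝ) :=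
      CompactSpace.uniformContinuous_of_continuous hlift
    have h2 : UniformContinuous (fun x : ℝ => (x : AddCircle (1 : ℝ))) :=
      uniformContinuous_of_continuousAt_zero
        (QuotientAddGroup.mk' (AddSubgroup.zmultiples (1 : ℝ))) (AddCircle.continuous_mk' 1).continuousAt
    exact h1.comp h2
  have h := this.add uniformContinuous_id
  simpa [Function.comp_def] using h

/-- The range contains the dense set `H 0 + ℤτ + ℤ`; surjectivity of `f` supplies the negative
multiples of `τ`. A monotone function with dense range is continuous. -/
theorem continuous_of_semiconj (hτ : Irrational τ) (hbij : Function.Bijective f)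
    (hH : ∀ x, H (f x) = H x + τ) : Continuous H := by
  refine H.monotone.continuous_of_denseRange ?_
  have hd : Dense (AddSubgroup.closure {τ, (1 : ℝ)} : Set ℝ) :=
    dense_addSubgroupClosure_pair_iff.2 (by simpa using hτ)
  have hd' := hd.vadd (H 0)
  refine hd'.mono ?_
  rintro _ ⟨y, hy, rfl⟩
  obtain ⟨m, k, rfl⟩ := AddSubgroup.mem_closure_pair.1 hy
  set e := Equiv.ofBijective f hbij
  have hz : ∀ m : ℤ, ∃ x, H x = H 0 + m * τ := by
    intro m
    induction m using Int.induction_on with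
    | zero => exact ⟨0, by simp⟩
    | succ i ih =>
      obtain ⟨x, hx⟩ := ih
      exact ⟨f x, by rw [hH, hx]; push_cast; ring⟩
    | pred i ih =>
      obtain ⟨x, hx⟩ := ih
      obtain ⟨y, rfl⟩ := hbij.2 x
      rw [hH] at hx
      exact ⟨y, by push_cast at hx ⊢; linarith⟩
  obtain ⟨x, hx⟩ := hz m
  refine ⟨x + k, ?_⟩
  rw [H.map_add_int, hx]
  simp
  ring

/-- Denjoy: a semiconjugacy to an irrational rotation is injective. -/
theorem strictMono_of_semiconj {K : ℝ} (hf : BoundedDistortion f K) (hK : 0 ≤ K)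
    (hmono : StrictMono f) (hτ : Irrational τ) (hcont : Continuous H)
    (hH : ∀ x, H (f x) = H x + τ) : StrictMono H := by
  refine H.monotone.strictMono_of_injective ?_
  by_contra hinj
  obtain ⟨p, q₀, hc₀, hlt₀⟩ : ∃ p q, H p = H q ∧ p < q := by
    simp only [Function.Injective, not_forall] at hinj
    obtain ⟨x, y, hxy, hne⟩ := hinj
    rcases lt_or_gt_of_ne hne with h | h
    · exact ⟨x, y, hxy, h⟩
    · exact ⟨y, x, hxy.symm, h⟩
  -- Taking `q` to be the right end of the level set ensures that `H` increases strictly beyond it.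
  set Z : Set ℝ := {x | H x = H p}
  have hbdd : BddAbove Z := ⟨p + 1, fun x hx =>
    (lt_add_one_of_map_lt (H := H) (by rw [show H x = H p from hx]; linarith)).le⟩
  have hmem : sSup Z ∈ Z :=
    (isClosed_eq hcont continuous_const).csSup_mem ⟨p, rfl⟩ hbdd
  set q := sSup Z
  have hpq : p < q := hlt₀.trans_le (le_csSup hbdd hc₀.symm)
  have hsum := sum_length_iterate_le_one hmono.monotone hτ hH hpq.le (Eq.symm hmem)
  obtain ⟨s, hqs, hs⟩ := hf.exists_extension hK hmono hpq hsum
  have hgap : H q < H s := by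
    refine lt_of_le_of_ne (H.monotone hqs.le) fun h => hqs.not_ge (le_csSup hbdd ?_)
    exact h.symm.trans hmem
  have hsummable : Summable fun n => f^[n] q - f^[n] p :=
    summable_of_sum_range_le (fun n => (sub_pos.2 (hmono.iterate n hpq)).le) hsum
  have hto : Tendsto (fun n => f^[n] s - f^[n] q) atTop (𝓝 0) :=
    squeeze_zero (fun n => (sub_pos.2 (hmono.iterate n hqs)).le) hs hsummable.tendsto_atTop_zero
  -- The images of `[q, s]` shrink to zero while `H` increases by `H s - H q` on each of them.
  obtain ⟨δ, hδ, huc⟩ := Metric.uniformContinuous_iff.1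
    (uniformContinuous_of_continuous_deg1 hcont) (H s - H q) (sub_pos.2 hgap)
  obtain ⟨n, hn⟩ := ((Metric.tendsto_nhds.1 hto) δ hδ).exists
  have h1 := huc (a := f^[n] s) (b := f^[n] q) (by simpa [Real.dist_eq] using hn)
  rw [semiconj_iterate hH, semiconj_iterate hH, Real.dist_eq] at h1
  have h2 := le_abs_self (H s + n * τ - (H q + n * τ))
  linarith

end Semiconj

theorem exists_conj_translation (f : CircleDeg1Lift) {K : ℝ} (hf : BoundedDistortion f K)
    (hK : 0 ≤ K) (hmono : StrictMono f) (hcont : Continuous f)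
    (hτ : Irrational f.translationNumber) :
    ∃ H : CircleDeg1Lift, Continuous H ∧ StrictMono H ∧
      ∀ x, H (f x) = H x + f.translationNumber := by
  have hbij : Function.Bijective f :=
    ⟨hmono.injective, f.continuous_iff_surjective.1 hcont⟩
  obtain ⟨H, hH⟩ := CircleDeg1Lift.semiconj_of_bijective_of_translationNumber_eq hbij
    (CircleDeg1Lift.isUnit_iff_bijective.1
      (CircleDeg1Lift.translate (Multiplicative.ofAdd f.translationNumber)).isUnit)
    (CircleDeg1Lift.translationNumber_translate _).symm
  have hH' : ∀ x, H (f x) = H x + f.translationNumber := fun x => by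
    rw [hH x, CircleDeg1Lift.translate_apply, add_comm]
  have hHc := continuous_of_semiconj hτ hbij hH'
  exact ⟨H, hHc, strictMono_of_semiconj hf hK hmono hτ hHc hH', hH'⟩

/-! ### Passing from the line to the circle. -/

theorem circle_exp_two_pi_eq_iff {x y : ℝ} :
    Circle.exp (2 * Real.pi * x) = Circle.exp (2 * Real.pi * y) ↔ ∃ m : ℤ, x = y + m := by
  rw [Circle.exp_eq_exp]
  refine exists_congr fun m => ?_
  rw [show 2 * Real.pi * y + m * (2 * Real.pi) = 2 * Real.pi * (y + m) by ring]
  exact mul_right_inj' Real.two_pi_pos.ne'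

theorem exists_exp_two_pi_eq (z : Circle) : ∃ x : ℝ, Circle.exp (2 * Real.pi * x) = z := by
  obtain ⟨x, rfl⟩ := Circle.exp_surjective z
  exact ⟨x / (2 * Real.pi), by rw [mul_div_cancel₀ _ Real.two_pi_pos.ne']⟩

/-- A strictly increasing continuous map of degree one descends to a homeomorphism of the circle. -/
theorem exists_circle_homeomorph (H : CircleDeg1Lift) (hcont : Continuous H)
    (hmono : StrictMono H) :
    ∃ h : Circle ≃ₜ Circle, ∀ x : ℝ,
      h (Circle.exp (2 * Real.pi * x)) = Circle.exp (2 * Real.pi * H x) := by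
  choose φ hφ using exists_exp_two_pi_eq
  set h₀ : Circle → Circle := fun z => Circle.exp (2 * Real.pi * H (φ z)) with hh₀
  -- Degree one makes `h₀` independent of the chosen angle `φ z`.
  have key : ∀ x : ℝ, h₀ (Circle.exp (2 * Real.pi * x)) = Circle.exp (2 * Real.pi * H x) := by
    intro x
    obtain ⟨m, hm⟩ := circle_exp_two_pi_eq_iff.1 (hφ (Circle.exp (2 * Real.pi * x)))
    exact circle_exp_two_pi_eq_iff.2 ⟨m, by rw [hm, H.map_add_int]⟩
  have hinj : Function.Injective h₀ := by
    intro z w hzw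
    obtain ⟨m, hm⟩ := circle_exp_two_pi_eq_iff.1 hzw
    rw [← H.map_add_int] at hm
    rw [← hφ z, ← hφ w]
    exact circle_exp_two_pi_eq_iff.2 ⟨m, hmono.injective hm⟩
  have hsurj : Function.Surjective h₀ := by
    intro w
    obtain ⟨y, hy⟩ := H.continuous_iff_surjective.1 hcont (φ w)
    exact ⟨Circle.exp (2 * Real.pi * y), by rw [key, hy, hφ]⟩
  have hquot : IsQuotientMap (Circle.exp : ℝ → Circle) :=
    isLocalHomeomorph_circleExp.isOpenMap.isQuotientMap Circle.exp.continuous Circle.exp_surjective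
  have hc : Continuous h₀ := by
    rw [hquot.continuous_iff]
    have : h₀ ∘ Circle.exp = fun x => Circle.exp (2 * Real.pi * H (x / (2 * Real.pi))) := by
      funext x
      rw [← key, mul_div_cancel₀ _ Real.two_pi_pos.ne']
      rfl
    rw [this]
    fun_prop
  exact ⟨Continuous.homeoOfEquivCompactToT2 (f := Equiv.ofBijective h₀ ⟨hinj, hsurj⟩) hc, key⟩

/-! ### Derivative and distortion of the lifts of `S a b`. -/

section Lift

variable (a b : ℝ)

/-- The curve `x ↦ T_ab (e^{2πix})`. -/
def curve (x : ℝ) : ℂ :=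
  ⟨a * max (Real.cos (2 * Real.pi * x)) 0 + b * min (Real.cos (2 * Real.pi * x)) 0 -
    Real.sin (2 * Real.pi * x), Real.cos (2 * Real.pi * x)⟩

theorem coe_exp_two_pi (x : ℝ) : (Circle.exp (2 * Real.pi * x) : ℂ) =
    ⟨Real.cos (2 * Real.pi * x), Real.sin (2 * Real.pi * x)⟩ := by
  rw [Circle.coe_exp]
  apply Complex.ext
  · rw [Complex.exp_ofReal_mul_I_re]
  · rw [Complex.exp_ofReal_mul_I_im]

/-- Positive and negative parts replace the case split, so continuity, Lipschitz bounds and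
homogeneity come from `max` and `min`. -/
theorem TC_mk (c s : ℝ) : TC a b ⟨c, s⟩ = ⟨a * max c 0 + b * min c 0 - s, c⟩ := by
  unfold TC T
  by_cases h : 0 ≤ c
  · apply Complex.ext <;> simp [h]
  · have h' := (not_le.1 h).le
    apply Complex.ext <;> simp [h, h']

theorem TC_exp (x : ℝ) : TC a b (Circle.exp (2 * Real.pi * x)) = curve a b x := by
  rw [coe_exp_two_pi, TC_mk, curve]

theorem curve_ne_zero (x : ℝ) : curve a b x ≠ 0 := by
  rw [← TC_exp]
  exact TC_ne_zero a b (Circle.coe_ne_zero _)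

theorem continuous_curve : Continuous (curve a b) := by
  have : curve a b = fun x : ℝ => ((a * max (Real.cos (2 * Real.pi * x)) 0 +
      b * min (Real.cos (2 * Real.pi * x)) 0 - Real.sin (2 * Real.pi * x) : ℝ) : ℂ) +
      ((Real.cos (2 * Real.pi * x) : ℝ) : ℂ) * Complex.I := by
    funext x
    exact Complex.mk_eq_add_mul_I _ _
  rw [this]
  fun_prop

theorem curve_periodic : Function.Periodic (curve a b) 1 := by
  intro x
  rw [← TC_exp, ← TC_exp, (circle_exp_two_pi_eq_iff (y := x)).2 ⟨1, by simp⟩]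

theorem exists_curve_lipschitz : ∃ L, 0 ≤ L ∧ ∀ x y, ‖curve a b x - curve a b y‖ ≤ L * |x - y| := by
  refine ⟨(|a| + |b| + 2) * (2 * Real.pi), by positivity, fun x y => ?_⟩
  set c := Real.cos (2 * Real.pi * x) with hc
  set c' := Real.cos (2 * Real.pi * y) with hc'
  have habs : |2 * Real.pi * x - 2 * Real.pi * y| = 2 * Real.pi * |x - y| := by
    rw [← mul_sub, abs_mul, abs_of_pos Real.two_pi_pos]
  have h1 : |c - c'| ≤ 2 * Real.pi * |x - y| := habs ▸ Real.abs_cos_sub_cos_le _ _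
  have h2 : |Real.sin (2 * Real.pi * x) - Real.sin (2 * Real.pi * y)| ≤ 2 * Real.pi * |x - y| :=
    habs ▸ Real.abs_sin_sub_sin_le _ _
  have h3 : |max c 0 - max c' 0| ≤ |c - c'| := abs_max_sub_max_le_abs _ _ _
  have h4 : |min c 0 - min c' 0| ≤ |c - c'| := by
    simpa using abs_min_sub_min_le_max c 0 c' 0
  refine (Complex.norm_le_abs_re_add_abs_im _).trans ?_
  have hre : |(curve a b x - curve a b y).re| ≤ |a| * |max c 0 - max c' 0| +
      |b| * |min c 0 - min c' 0| +
      |Real.sin (2 * Real.pi * x) - Real.sin (2 * Real.pi * y)| := by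
    rw [← abs_mul, ← abs_mul]
    have : (curve a b x - curve a b y).re = a * (max c 0 - max c' 0) + b * (min c 0 - min c' 0) -
        (Real.sin (2 * Real.pi * x) - Real.sin (2 * Real.pi * y)) := by
      simp only [curve, Complex.sub_re, ← hc, ← hc']
      ring
    rw [this]
    exact (abs_sub _ _).trans (add_le_add_left (abs_add_le _ _) _)
  have him : |(curve a b x - curve a b y).im| = |c - c'| := rfl
  have h5 := mul_le_mul_of_nonneg_left (h3.trans h1) (abs_nonneg a)
  have h6 := mul_le_mul_of_nonneg_left (h4.trans h1) (abs_nonneg b)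
  rw [him]
  linarith

theorem exists_le_norm_curve : ∃ m, 0 < m ∧ ∀ x, m ≤ ‖curve a b x‖ := by
  obtain ⟨x₀, -, hx₀⟩ := isCompact_Icc.exists_isMinOn (nonempty_Icc.2 (zero_le_one' ℝ))
    (continuous_curve a b).norm.continuousOn
  refine ⟨‖curve a b x₀‖, norm_pos_iff.2 (curve_ne_zero a b x₀), fun x => ?_⟩
  have h := hx₀ (show Int.fract x ∈ Icc (0 : ℝ) 1 from
    ⟨Int.fract_nonneg x, (Int.fract_lt_one x).le⟩)
  have h' : curve a b (Int.fract x) = curve a b x := by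
    have := (curve_periodic a b).sub_int_mul_eq ⌊x⌋ (x := x)
    rwa [mul_one] at this
  exact h' ▸ h

/-- The derivative of the lifts of `S_ab`. -/
def density (x : ℝ) : ℝ := (‖curve a b x‖ ^ 2)⁻¹

theorem density_pos (x : ℝ) : 0 < density a b x := by
  have := norm_pos_iff.2 (curve_ne_zero a b x)
  unfold density
  positivity

theorem continuous_density : Continuous (density a b) :=
  ((continuous_curve a b).norm.pow 2).inv₀ fun x =>
    pow_ne_zero 2 (norm_ne_zero_iff.2 (curve_ne_zero a b x))

/-- The norm of the curve is `L`-Lipschitz and at least `m`, so its logarithm is `L / m`-Lipschitz;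
the density is its power `-2`. -/
theorem exists_density_le : ∃ K, 0 ≤ K ∧
    ∀ x y, density a b x ≤ Real.exp (K * |x - y|) * density a b y := by
  obtain ⟨L, hL, hlip⟩ := exists_curve_lipschitz a b
  obtain ⟨m, hm, hmin⟩ := exists_le_norm_curve a b
  refine ⟨2 * (L / m), by positivity, fun x y => ?_⟩
  have hx := norm_pos_iff.2 (curve_ne_zero a b x)
  have hy := norm_pos_iff.2 (curve_ne_zero a b y)
  have h1 : ‖curve a b y‖ ≤ Real.exp (L / m * |x - y|) * ‖curve a b x‖ := by
    have h2 : ‖curve a b y‖ ≤ ‖curve a b x‖ + L * |x - y| := by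
      have := norm_sub_norm_le (curve a b y) (curve a b x)
      have := hlip y x
      rw [abs_sub_comm] at this
      linarith
    have h3 : L * |x - y| ≤ L / m * |x - y| * ‖curve a b x‖ := by
      calc L * |x - y| = L / m * |x - y| * m := by field_simp
        _ ≤ _ := by gcongr; exact hmin x
    have h4 := mul_le_mul_of_nonneg_right (Real.add_one_le_exp (L / m * |x - y|)) hx.le
    linarith
  have h5 : ‖curve a b y‖ ^ 2 ≤ Real.exp (2 * (L / m) * |x - y|) * ‖curve a b x‖ ^ 2 := by
    calc _ ≤ (Real.exp (L / m * |x - y|) * ‖curve a b x‖) ^ 2 := by gcongr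
      _ = _ := by rw [mul_pow, ← Real.exp_nat_mul]; push_cast; ring_nf
  unfold density
  rw [← div_eq_mul_inv, inv_eq_one_div, div_le_div_iff₀ (by positivity) (by positivity)]
  linarith

/-- For a plane curve `w`, the imaginary part of `w' / w` is `det (w, w') / ‖w‖ ^ 2`. Each linear
branch preserves the determinant, which is `2π` for `e^{2πix}`. -/
theorem hasDerivAt_curve {x : ℝ} (hx : Real.cos (2 * Real.pi * x) ≠ 0) :
    ∃ D' : ℂ, HasDerivAt (curve a b) D' x ∧
      (D' / curve a b x).im = 2 * Real.pi * density a b x := by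
  have hlin : HasDerivAt (fun x : ℝ => 2 * Real.pi * x) (2 * Real.pi) x := by
    simpa using (hasDerivAt_id x).const_mul (2 * Real.pi)
  have hcos := hlin.cos
  have hsin := hlin.sin
  have hcont : Continuous fun y : ℝ => Real.cos (2 * Real.pi * y) := by fun_prop
  obtain ⟨α, hα⟩ : ∃ α : ℝ, ∀ᶠ y in 𝓝 x, curve a b y =
      ⟨α * Real.cos (2 * Real.pi * y) - Real.sin (2 * Real.pi * y), Real.cos (2 * Real.pi * y)⟩ := by
    rcases lt_or_gt_of_ne hx with h | h
    · refine ⟨b, (hcont.continuousAt.eventually_lt_const h).mono fun y hy => ?_⟩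
      simp [curve, hy.le]
    · refine ⟨a, (hcont.continuousAt.eventually_const_lt h).mono fun y hy => ?_⟩
      simp [curve, hy.le]
  have hd := (((hcos.const_mul α).sub hsin).ofReal_comp).add
    ((hcos.ofReal_comp).mul_const Complex.I)
  refine ⟨_, hd.congr_of_eventuallyEq (hα.mono fun y hy => ?_), ?_⟩
  · rw [hy, Complex.mk_eq_add_mul_I]
    simp
  · have hval := hα.self_of_nhds
    have hsq := Real.sin_sq_add_cos_sq (2 * Real.pi * x)
    rw [Complex.div_im, density, ← Complex.normSq_eq_norm_sq, hval]
    set c := Real.cos (2 * Real.pi * x)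
    set s := Real.sin (2 * Real.pi * x)
    simp only [Complex.add_im, Complex.ofReal_im, Complex.mul_im, Complex.ofReal_re, Complex.I_im,
      Complex.I_re, Complex.add_re, Complex.mul_re]
    rw [← sub_div, div_eq_mul_inv]
    congr 1
    linear_combination (2 * Real.pi) * hsq

theorem countable_cos_eq_zero : {x : ℝ | Real.cos (2 * Real.pi * x) = 0}.Countable := by
  refine (countable_range fun k : ℤ => (2 * (k : ℝ) + 1) * Real.pi / 2 / (2 * Real.pi)).mono ?_
  rintro x hx
  obtain ⟨k, hk⟩ := Real.cos_eq_zero_iff.1 hx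
  exact ⟨k, by simp only [← hk]; exact mul_div_cancel_left₀ _ Real.two_pi_pos.ne'⟩

variable {a b} {F : ℝ → ℝ}

theorem IsLift.coe_exp (hF : IsLift (S a b) F) (x : ℝ) :
    Complex.exp ((2 * Real.pi * F x : ℝ) * Complex.I) = curve a b x / ‖curve a b x‖ := by
  rw [← Circle.coe_exp, hF.2 x, ← TC_exp]
  rfl

/-- Dividing by `curve a b x` moves the base point to 1, where the principal logarithm is
differentiable and its imaginary part recovers `F y - F x`. -/
theorem IsLift.hasDerivAt (hF : IsLift (S a b) F) {x : ℝ}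
    (hx : Real.cos (2 * Real.pi * x) ≠ 0) : HasDerivAt F (density a b x) x := by
  obtain ⟨D', hD, him⟩ := hasDerivAt_curve a b hx
  have hx0 := curve_ne_zero a b x
  have hq : HasDerivAt (fun y => curve a b y / curve a b x) (D' / curve a b x) x :=
    hD.div_const _
  have hlog := hq.clog_real (by simp [hx0])
  simp only [div_self hx0, div_one] at hlog
  have him' : HasDerivAt (fun y => (Complex.log (curve a b y / curve a b x)).im)
      (D' / curve a b x).im x :=
    (Complex.imCLM.hasFDerivAt.comp_hasDerivAt x hlog)
  have hF' : HasDerivAt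
      (fun y => F x + (Complex.log (curve a b y / curve a b x)).im / (2 * Real.pi))
      (density a b x) x := by
    have := (him'.div_const (2 * Real.pi)).const_add (F x)
    rwa [him, mul_div_cancel_left₀ _ Real.two_pi_pos.ne'] at this
  refine hF'.congr_of_eventuallyEq ?_
  -- The bound `1 / 2` keeps the angle `2π (F y - F x)` inside `(-π, π)`, so the principal argument
  -- equals it.
  have hnear : ∀ᶠ y in 𝓝 x, |F y - F x| < 1 / 2 := by
    simpa [Real.dist_eq] using Metric.continuous_iff'.1 hF.1 x (1 / 2) (by norm_num)
  refine hnear.mono fun y hy => ?_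
  have hy0 := curve_ne_zero a b y
  rw [abs_lt] at hy
  have hpi := Real.pi_pos
  have harg : (Complex.log (curve a b y / curve a b x)).im = 2 * Real.pi * (F y - F x) := by
    have h1 : curve a b y / curve a b x = ((‖curve a b y‖ / ‖curve a b x‖ : ℝ) : ℂ) *
        Complex.exp ((2 * Real.pi * (F y - F x) : ℝ) * Complex.I) := by
      have h2 : Complex.exp ((2 * Real.pi * (F y - F x) : ℝ) * Complex.I) =
          (curve a b y / ‖curve a b y‖) / (curve a b x / ‖curve a b x‖) := by
        rw [← hF.coe_exp, ← hF.coe_exp, ← Complex.exp_sub]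
        congr 1
        push_cast
        ring
      rw [h2]
      have : (‖curve a b x‖ : ℂ) ≠ 0 := by simpa using hx0
      have : (‖curve a b y‖ : ℂ) ≠ 0 := by simpa using hy0
      push_cast
      field_simp
    rw [Complex.log_im, h1, Complex.arg_real_mul _ (div_pos (norm_pos_iff.2 hy0)
      (norm_pos_iff.2 hx0)), Complex.arg_exp_mul_I, toIocMod_eq_self]
    constructor <;> nlinarith
  dsimp only
  rw [harg, mul_div_cancel_left₀ _ Real.two_pi_pos.ne']
  ring

theorem IsLift.integral_density (hF : IsLift (S a b) F) (x y : ℝ) :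
    ∫ t in x..y, density a b t = F y - F x :=
  MeasureTheory.integral_eq_of_hasDerivAt_off_countable F _ countable_cos_eq_zero
    hF.1.continuousOn (fun _ ht => hF.hasDerivAt ht.2)
    ((continuous_density a b).intervalIntegrable _ _)

theorem IsLift.strictMono (hF : IsLift (S a b) F) : StrictMono F := fun x y hxy => by
  rw [← sub_pos, ← hF.integral_density]
  exact intervalIntegral.intervalIntegral_pos_of_pos
    ((continuous_density a b).intervalIntegrable _ _) (density_pos a b) hxy

/-- On both intervals the density is compared with its value at the common endpoint `q`. -/
theorem IsLift.exists_boundedDistortion (hF : IsLift (S a b) F) :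
    ∃ K, 0 ≤ K ∧ BoundedDistortion F K := by
  obtain ⟨K, hK, hle⟩ := exists_density_le a b
  refine ⟨K, hK, fun p q s hpq hqs => ?_⟩
  have hint : ∀ u v, IntervalIntegrable (density a b) MeasureTheory.volume u v :=
    fun u v => (continuous_density a b).intervalIntegrable u v
  have h1 : F s - F q ≤ (s - q) * (Real.exp (K * (s - q)) * density a b q) := by
    rw [← hF.integral_density]
    calc _ ≤ ∫ _ in q..s, Real.exp (K * (s - q)) * density a b q := by
          refine intervalIntegral.integral_mono_on hqs (hint _ _) (by simp) fun t ht => ?_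
          refine (hle t q).trans (mul_le_mul_of_nonneg_right ?_ (density_pos a b q).le)
          rw [abs_of_nonneg (sub_nonneg.2 ht.1)]
          gcongr
          exact ht.2
      _ = _ := by simp [mul_left_comm]
  have h2 : (q - p) * density a b q ≤ Real.exp (K * (q - p)) * (F q - F p) := by
    rw [← hF.integral_density, ← intervalIntegral.integral_const_mul]
    calc _ = ∫ _ in p..q, density a b q := by simp
      _ ≤ _ := by
        refine intervalIntegral.integral_mono_on hpq (by simp) ((hint _ _).const_mul _)
          fun t ht => ?_
        refine (hle q t).trans (mul_le_mul_of_nonneg_right ?_ (density_pos a b t).le)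
        rw [abs_of_nonneg (sub_nonneg.2 ht.2)]
        gcongr
        exact ht.1
  calc (F s - F q) * (q - p) ≤ (s - q) * (Real.exp (K * (s - q)) * density a b q) * (q - p) :=
        mul_le_mul_of_nonneg_right h1 (sub_nonneg.2 hpq)
    _ = (s - q) * Real.exp (K * (s - q)) * ((q - p) * density a b q) := by ring
    _ ≤ (s - q) * Real.exp (K * (s - q)) * (Real.exp (K * (q - p)) * (F q - F p)) :=
        mul_le_mul_of_nonneg_left h2 (mul_nonneg (sub_nonneg.2 hqs) (Real.exp_pos _).le)
    _ = Real.exp (K * (s - q) + K * (q - p)) * (F q - F p) * (s - q) := by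
        rw [Real.exp_add]; ring
    _ = _ := by ring_nf

/-! ### Injectivity of `S a b` and degree one of its lifts. -/

theorem S_injective (a b : ℝ) : Function.Injective (S a b) := by
  intro z w h
  obtain ⟨x, rfl⟩ := exists_exp_two_pi_eq z
  obtain ⟨y, rfl⟩ := exists_exp_two_pi_eq w
  have h' : curve a b x / ‖curve a b x‖ = curve a b y / ‖curve a b y‖ := by
    have := congrArg (fun u : Circle => (u : ℂ)) h
    simpa only [S, TC_exp] using this
  have hx := norm_pos_iff.2 (curve_ne_zero a b x)
  have hy := norm_pos_iff.2 (curve_ne_zero a b y)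
  -- Equal directions mean that the images differ by a positive factor `l`. Positive homogeneity of
  -- `T` passes `l` to the unit vectors themselves, hence `l = 1`.
  set l := ‖curve a b x‖ / ‖curve a b y‖ with hl
  have hl0 : 0 < l := div_pos hx hy
  have heq : curve a b x = (l : ℂ) * curve a b y := by
    have h1 : (‖curve a b x‖ : ℂ) ≠ 0 := by exact_mod_cast hx.ne'
    have h2 : (‖curve a b y‖ : ℂ) ≠ 0 := by exact_mod_cast hy.ne'
    rw [hl]
    push_cast
    field_simp at h' ⊢
    linear_combination h'
  have him := congrArg Complex.im heq
  have hre := congrArg Complex.re heq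
  rw [Complex.im_ofReal_mul] at him
  rw [Complex.re_ofReal_mul] at hre
  simp only [curve] at him hre
  have hsx := Real.sin_sq_add_cos_sq (2 * Real.pi * x)
  have hsy := Real.sin_sq_add_cos_sq (2 * Real.pi * y)
  apply Circle.ext
  rw [coe_exp_two_pi, coe_exp_two_pi]
  set c := Real.cos (2 * Real.pi * x)
  set c' := Real.cos (2 * Real.pi * y)
  set s := Real.sin (2 * Real.pi * x)
  set s' := Real.sin (2 * Real.pi * y)
  have hmax : max c 0 = l * max c' 0 := by
    rw [him, mul_max_of_nonneg _ _ hl0.le, mul_zero]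
  have hmin : min c 0 = l * min c' 0 := by
    rw [him, mul_min_of_nonneg _ _ hl0.le, mul_zero]
  have hs : s = l * s' := by
    rw [hmax, hmin] at hre
    linear_combination -hre
  have hl1 : l = 1 := by
    have : l ^ 2 = 1 := by
      rw [him, hs] at hsx
      linear_combination hsx - l ^ 2 * hsy
    exact (pow_eq_one_iff_of_nonneg hl0.le two_ne_zero).1 this
  rw [him, hs, hl1, one_mul, one_mul]

/-- The degree is an integer, positive by monotonicity. Injectivity of `S a b` excludes a larger
one: the value `F x + 1`, attained on `[x, x + 1]`, can only be attained at `x + 1`. -/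
theorem IsLift.map_add_one (hF : IsLift (S a b) F) (x : ℝ) : F (x + 1) = F x + 1 := by
  have hexp : ∀ y z, Circle.exp (2 * Real.pi * F y) = Circle.exp (2 * Real.pi * F z) →
      ∃ m : ℤ, y = z + m := fun y z h => by
    rw [hF.2, hF.2] at h
    exact circle_exp_two_pi_eq_iff.1 (S_injective a b h)
  obtain ⟨m, hm⟩ : ∃ m : ℤ, F (x + 1) = F x + m := by
    rw [← circle_exp_two_pi_eq_iff, hF.2, hF.2, (circle_exp_two_pi_eq_iff (y := x)).2 ⟨1, by simp⟩]
  have hlt := hF.strictMono (lt_add_one x)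
  have hm0 : 0 < m := by
    rw [hm] at hlt
    exact_mod_cast (lt_add_iff_pos_right _).1 hlt
  have hm1 : (1 : ℝ) ≤ m := by exact_mod_cast hm0
  obtain ⟨y, hy, hFy⟩ : F x + 1 ∈ F '' Icc x (x + 1) :=
    intermediate_value_Icc (by linarith) hF.1.continuousOn ⟨by linarith, by linarith⟩
  obtain ⟨k, hk⟩ := hexp y x (circle_exp_two_pi_eq_iff.2 ⟨1, by rw [hFy]; simp⟩)
  have hk0 : k ≠ 0 := by
    rintro rfl
    rw [hk] at hFy
    simp at hFy
  have hk1 : k = 1 := by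
    have h1 : (0 : ℝ) ≤ k := by linarith [hy.1]
    have h2 : (k : ℝ) ≤ 1 := by linarith [hy.2]
    have h1' : 0 ≤ k := by exact_mod_cast h1
    have h2' : k ≤ 1 := by exact_mod_cast h2
    omega
  rw [hk, hk1, Int.cast_one] at hFy
  exact hFy

end Lift

end PLMap

end

/-! ### The conjugacy to the rotation. -/

theorem theorem5p1 (a b r : ℝ) (hr : PLMap.HasRotationNumber (PLMap.S a b) r)
    (hirr : Irrational r) :
    ∃ h : Circle ≃ₜ Circle, ⇑h ∘ PLMap.S a b ∘ ⇑h.symm = PLMap.rotation r := by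
  obtain ⟨F, hF, hlim⟩ := hr
  obtain ⟨K, hK, hdist⟩ := hF.exists_boundedDistortion
  let f : CircleDeg1Lift := ⟨⟨F, hF.strictMono.monotone⟩, hF.map_add_one⟩
  have hτ : f.translationNumber = r := by
    refine tendsto_nhds_unique (f.tendsto_translationNumber 0) ?_
    simpa only [CircleDeg1Lift.coe_pow] using! hlim 0
  obtain ⟨H, hHc, hHm, hH⟩ := PLMap.exists_conj_translation f hdist hK hF.strictMono hF.1
    (hτ ▸ hirr)
  obtain ⟨h, hh⟩ := PLMap.exists_circle_homeomorph H hHc hHm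
  refine ⟨h, ?_⟩
  funext w
  obtain ⟨z, rfl⟩ := h.surjective w
  obtain ⟨x, rfl⟩ := PLMap.exists_exp_two_pi_eq z
  have hHx : H (F x) = H x + r := hτ ▸ hH x
  simp only [Function.comp_apply, h.symm_apply_apply]
  rw [← hF.2, hh, hh, hHx, PLMap.rotation, ← Circle.exp_add]
  congr 1
  ring
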